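/- Let $d\ge 0$, let $I\subseteq\mathbb R$ be a non-degenerate interval of times (open, closed or half-open, bounded or not; at an end point that belongs to $I$ time derivatives are one-sided). Let $\pi>0$ be a $C^1$ probability density on $\mathbb R^d$, and let $\pi_t>0$, $t\in I$, be (not necessarily normalized) densities on $\mathbb R^d$, differentiable in $x$, with $(t,x)\mapsto\nabla\log\pi_t(x)$ continuous on $I\times\mathbb R^d$. For a vector field $s$ and positive densities $f,q$ write $$L(s,f)=\mathbb E_f\|s-\nabla\log f\|^2,\qquad F(f\|q)=\mathbb E_f\Big\|\nabla\log\frac fq\Big\|^2,\qquad \mathrm{KL}(f\|q)=\mathbb E_f\log\frac fq .$$ Let $s_t$ be a time-dependent vector field, continuous in $(t,x)\in I\times\mathbb R^d$, and let $X_t$ be a random process whose paths almost surely satisfy $$\frac{dX_t}{dt}=\nabla\log\pi_t(X_t)-s_t(X_t),\qquad t\in I .$$ Suppose that $X_t$ has a density $f_t>0$ with $(t,x)\mapsto f_t(x)$ of class $C^1$ on $I\times\mathbb R^d$, that $\mathrm{KL}(f_{t}\|\pi)<\infty$ for some $t\in I$, and that, locally uniformly in $t\in I$, the functions $|\partial_tf_t|$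 and $f_t\,|\langle s_t-\nabla\log\pi_t,\nabla\log\frac{f_t}{\pi}\rangle|$ of $x$ are bounded by Lebesgue-integrable functions of $x$. (1) For every $t\in I$, $\mathrm{KL}(f_t\|\pi)<\infty$, the function $t\mapsto\mathrm{KL}(f_t\|\pi)$ is differentiable on $I$, and $$-\frac{d}{dt}\mathrm{KL}(f_t\|\pi)=\mathbb E_{f_t}\Big\langle s_t-\nabla\log\pi_t,\nabla\log\frac{f_t}{\pi}\Big\rangle ,$$ where the expectation converges absolutely. (2) For every $t\in I$ with $L(s_t,f_t)\,F(f_t\|\pi)<\infty$ (with $0\cdot\infty=0$), the expectation $\mathbb E_{f_t}\langle\nabla\log\frac{f_t}{\pi_t},\nabla\log\frac{f_t}{\pi}\rangle$ converges absolutely and $$\Big|\mathbb E_{f_t}\Big\langle s_t-\nabla\log\pi_t,\nabla\log\frac{f_t}{\pi}\Big\rangle-\mathbb E_{f_t}\Big\langle\nabla\log\frac{f_t}{\pi_t},\nabla\log\frac{f_t}{\pi}\Big\rangle\Big|\le\sqrt{L(s_t,f_t)\,F(f_t\|\pi)} .$$ (3) Consequently, as $L(s_t,f_t)\to0$ with $F(f_t\|\pi)$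 bounded, along any family of such fields $s$, processes $X$ with densities $f$, and times $t\in I$ (for fixed $\pi$ and $\pi_t$), $$-\frac{d}{dt}\mathrm{KL}(f_t\|\pi)-\mathbb E_{f_t}\Big\langle\nabla\log\frac{f_t}{\pi_t},\nabla\log\frac{f_t}{\pi}\Big\rangle\to0\quad\text{at the rate }O\big(\sqrt{L(s_t,f_t)}\big).$$ -/

import Mathlib

open MeasureTheory ProbabilityTheory InformationTheory Set Filter Topology Asymptotics
open scoped ENNReal NNReal

noncomputable section

/-- The state space `ℝ^d` with its Euclidean norm. -/
abbrev Space (d : ℕ) : Type := EuclideanSpace ℝ (Fin d)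

/-- The measure `p(x) dx` on `ℝ^d`. -/
def densityMeasure {d : ℕ} (p : Space d → ℝ) : Measure (Space d) :=
  volume.withDensity (fun x => ENNReal.ofReal (p x))

/-- The score `∇ log p`. -/
def score {d : ℕ} (p : Space d → ℝ) (x : Space d) : Space d :=
  gradient (fun y => Real.log (p y)) x

/-- The relative score `∇ log (p / q)`. -/
def relScore {d : ℕ} (p q : Space d → ℝ) (x : Space d) : Space d :=
  gradient (fun y => Real.log (p y / q y)) x

/-- The score-matching loss `L(s, p) = E_p ‖s - ∇ log p‖²`, with values in `[0, ∞]`. -/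
def scoreLoss {d : ℕ} (s : Space d → Space d) (p : Space d → ℝ) : ℝ≥0∞ :=
  ∫⁻ x, ‖s x - score p x‖ₑ ^ 2 ∂(densityMeasure p)

/-- The relative Fisher information `F(p ‖ q) = E_p ‖∇ log (p / q)‖²`, with values in `[0, ∞]`. -/
def relFisher {d : ℕ} (p q : Space d → ℝ) : ℝ≥0∞ :=
  ∫⁻ x, ‖relScore p q x‖ₑ ^ 2 ∂(densityMeasure p)

/-- The relative entropy `KL(p ‖ q)` as a real number; it is meaningful where
`klDiv (densityMeasure p) (densityMeasure q) ≠ ∞`. -/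
def relEntropy {d : ℕ} (p q : Space d → ℝ) : ℝ :=
  (klDiv (densityMeasure p) (densityMeasure q)).toReal

/-- `X` is a random solution, over the time interval `I`, of the ordinary differential equation
`dX_t/dt = ∇ log π_t (X_t) - s_t (X_t)`, the random variable `X_t` has the density `f_t`, and
the data are regular and decay at infinity (locally uniformly in time) as is needed for
`KL(f_t ‖ π)` and its dissipation to make sense. -/
structure IsAnnealedDynamics {d : ℕ} (I : Set ℝ) (π : Space d → ℝ) (πt : ℝ → Space d → ℝ)
    (s : ℝ → Space d → Space d) (f : ℝ → Space d → ℝ)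
    {Ω : Type*} [MeasurableSpace Ω] (P : Measure Ω) (X : ℝ → Ω → Space d) : Prop where
  /-- Almost every path solves the equation. -/
  ode : ∀ᵐ ω ∂P, ∀ t ∈ I,
    HasDerivWithinAt (fun τ => X τ ω) (score (πt t) (X t ω) - s t (X t ω)) I t
  /-- `f_t` is the density of `X_t`. -/
  law : ∀ t ∈ I, HasLaw (X t) (densityMeasure (f t)) P
  /-- The vector field `s` is continuous in time and space. -/
  continuousOn_field : ContinuousOn (fun z : ℝ × Space d => s z.1 z.2) (I ×ˢ univ)
  /-- The density `f` is positive. -/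
  pos : ∀ t ∈ I, ∀ x, 0 < f t x
  /-- The density `f` is continuously differentiable in time and space. -/
  contDiffOn : ContDiffOn ℝ 1 (fun z : ℝ × Space d => f z.1 z.2) (I ×ˢ univ)
  /-- The relative entropy is finite at some time. -/
  finite_entropy : ∃ t ∈ I, klDiv (densityMeasure (f t)) (densityMeasure π) ≠ ∞
  /-- Locally in time, `∂_t f_t` has an integrable majorant. -/
  dominated_deriv : ∀ t₀ ∈ I, ∃ g : Space d → ℝ, Integrable g ∧
    ∀ᶠ t in 𝓝[I] t₀, ∀ x, |derivWithin (fun τ => f τ x) I t| ≤ g x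
  /-- Locally in time, `f_t ⟨s_t - ∇ log π_t, ∇ log (f_t / π)⟩` has an integrable majorant. -/
  dominated_dissipation : ∀ t₀ ∈ I, ∃ g : Space d → ℝ, Integrable g ∧
    ∀ᶠ t in 𝓝[I] t₀, ∀ x,
      f t x * |inner ℝ (s t x - score (πt t) x) (relScore (f t) π x)| ≤ g x

end

/-!
Along a trajectory of `dX_t/dt = v_t (X_t)`, the function `log (f_t / π)` evaluated at `X_t` has the
derivative `∂_t f_t / f_t + ⟨v_t, ∇ log (f_t / π)⟩`. Multiplied by the density `f_t`, both terms
have integrable majorants locally uniformly in time, so the pathwise fundamental theorem of calculus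
may be integrated over the sample space: finiteness of `KL(f_t ‖ π) = E log (f_t / π)(X_t)`, up to
constants, propagates from one time to all times, and its derivative is the expectation above. The
first term contributes `∫ ∂_t f_t = 0` by conservation of mass. This argument avoids the continuity
equation and any integration by parts, hence boundary conditions at infinity.

The comparison with `E ⟨∇ log (f / π_t), ∇ log (f / π)⟩` is Cauchy–Schwarz, since
`∇ log (f / π_t) = (s - ∇ log π_t) - (s - ∇ log f)`.
-/

section Calculus

theorem uniqueDiffOn_of_ordConnected {I : Set ℝ} (hI : I.OrdConnected) (hI' : I.Nontrivial) :
    UniqueDiffOn ℝ I :=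
  uniqueDiffOn_convex hI.convex (hI.convex.nontrivial_iff_nonempty_interior.1 hI')

variable {E : Type*} [NormedAddCommGroup E] [NormedSpace ℝ E] {I : Set ℝ} {F F' : ℝ → E}

theorem hasDerivWithinAt_of_sub_eq_intervalIntegral [CompleteSpace E]
    (hI : I.OrdConnected) (hF' : ContinuousOn F' I) {t : ℝ} (ht : t ∈ I)
    (hF : ∀ u ∈ I, F u - F t = ∫ r in t..u, F' r) : HasDerivWithinAt F (F' t) I t := by
  have htends : Tendsto F' (𝓝[I] t ⊓ ae volume) (𝓝 (F' t)) := (hF' t ht).mono_left inf_le_left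
  have hmeas : StronglyMeasurableAtFilter F' (𝓝[I] t) volume :=
    ⟨I, self_mem_nhdsWithin, hF'.aestronglyMeasurable hI.measurableSet⟩
  have : TendstoIxxClass Ioc (𝓟 I) (𝓟 I) := tendstoIxxClass_principal.2 fun _ hx _ hy =>
    Ioc_subset_Icc_self.trans (hI.out hx hy)
  have := hI.measurableSet.nhdsWithin_isMeasurablyGenerated t
  have h := intervalIntegral.measure_integral_sub_linear_isLittleO_of_tendsto_ae' hmeas htends
    (volume.finiteAt_nhdsWithin t I) (tendsto_const_nhdsWithin ht) tendsto_id
  simp only [intervalIntegral.integral_const, smul_eq_mul, mul_one] at h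
  rw [hasDerivWithinAt_iff_isLittleO]
  refine h.congr' ?_ .rfl
  filter_upwards [self_mem_nhdsWithin] with u hu
  rw [hF u hu]; rfl

theorem intervalIntegral_eq_sub_of_hasDerivWithinAt [CompleteSpace E]
    (hI : I.OrdConnected) (hF : ∀ t ∈ I, HasDerivWithinAt F (F' t) I t) (hF' : ContinuousOn F' I)
    {a b : ℝ} (ha : a ∈ I) (hb : b ∈ I) : ∫ t in a..b, F' t = F b - F a := by
  have hsub : uIcc a b ⊆ I := hI.uIcc_subset ha hb
  refine intervalIntegral.integral_eq_sub_of_hasDeriv_right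
    (fun t ht => (hF t (hsub ht)).continuousWithinAt.mono hsub) (fun t ht => ?_)
    (hF'.mono hsub).intervalIntegrable
  exact ((hF t (hsub (Ioo_subset_Icc_self ht))).hasDerivAt
    (mem_of_superset (Icc_mem_nhds ht.1 ht.2) hsub)).hasDerivWithinAt

end Calculus

section JointMeasurability

theorem aestronglyMeasurable_simpleFunc_bind {α β E : Type*} [MeasurableSpace α]
    [TopologicalSpace E] [TopologicalSpace.PseudoMetrizableSpace E] {μ : Measure α}
    (f : SimpleFunc α β) {g : β → α → E}
    (hg : ∀ b ∈ f.range, AEStronglyMeasurable (g b) μ) :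
    AEStronglyMeasurable (fun a => g (f a) a) μ := by
  have hcover : ⋃ b : f.range, f ⁻¹' {(b : β)} = univ := by
    simp [eq_univ_iff_forall]
  rw [← Measure.restrict_univ (μ := μ), ← hcover, aestronglyMeasurable_iUnion_iff]
  rintro ⟨b, hb⟩
  refine (hg b hb).restrict.congr ?_
  filter_upwards [ae_restrict_mem (f.measurableSet_fiber b)] with a ha
  rw [show f a = b from ha]

/-- The process is the limit of its time discretizations, which are measurable because they only
involve finitely many times. -/
theorem aestronglyMeasurable_uncurry_of_ae_continuousOn {T Ω E : Type*} [PseudoEMetricSpace T]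
    [SecondCountableTopology T] [MeasurableSpace T] [OpensMeasurableSpace T] [MeasurableSpace Ω]
    [TopologicalSpace E] [TopologicalSpace.PseudoMetrizableSpace E] {μ : Measure T} {P : Measure Ω}
    [SFinite P] {S : Set T} (hS : MeasurableSet S) {X : T → Ω → E}
    (hX : ∀ t ∈ S, AEStronglyMeasurable (X t) P)
    (hX_cont : ∀ᵐ ω ∂P, ContinuousOn (fun t => X t ω) S) :
    AEStronglyMeasurable (Function.uncurry X) ((μ.restrict S).prod P) := by
  rcases S.eq_empty_or_nonempty with rfl | ⟨t₀, ht₀⟩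
  · simp
  let discr : ℕ → SimpleFunc T T := SimpleFunc.approxOn id measurable_id S t₀ ht₀
  have hdiscr : ∀ n t, discr n t ∈ S := SimpleFunc.approxOn_mem measurable_id ht₀
  refine aestronglyMeasurable_of_tendsto_ae (u := atTop)
    (f := fun n (z : T × Ω) => X (discr n z.1) z.2) (fun n => ?_) ?_
  · refine aestronglyMeasurable_simpleFunc_bind ((discr n).comp Prod.fst measurable_fst)
      (g := fun t z => X t z.2) fun t ht => ?_
    obtain ⟨z, rfl⟩ := SimpleFunc.mem_range.1 ht
    exact (hX _ (hdiscr n z.1)).comp_snd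
  · filter_upwards [Measure.quasiMeasurePreserving_fst.ae (ae_restrict_mem hS),
      Measure.quasiMeasurePreserving_snd.ae hX_cont] with z hz hz_cont
    refine (hz_cont z.1 hz).tendsto.comp (tendsto_nhdsWithin_iff.2 ⟨?_, ?_⟩)
    · exact SimpleFunc.tendsto_approxOn measurable_id ht₀ (subset_closure hz)
    · exact Eventually.of_forall fun n => hdiscr n z.1

end JointMeasurability

/-- `Z'` is a pathwise time derivative on `I` of the random function `Z`, regular enough to be
exchanged with the integral over the sample space. -/
structure IsPathwiseDeriv {Ω E : Type*} [MeasurableSpace Ω] [NormedAddCommGroup E]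
    [NormedSpace ℝ E] (I : Set ℝ) (Z Z' : ℝ → Ω → E) (P : Measure Ω) : Prop where
  hasDerivWithinAt : ∀ᵐ ω ∂P, ∀ t ∈ I, HasDerivWithinAt (fun τ => Z τ ω) (Z' t ω) I t
  ae_continuousOn : ∀ᵐ ω ∂P, ContinuousOn (fun t => Z' t ω) I
  integrable_deriv : ∀ t ∈ I, Integrable (Z' t) P
  continuousOn_integral_norm : ContinuousOn (fun t => ∫ ω, ‖Z' t ω‖ ∂P) I
  continuousOn_integral : ContinuousOn (fun t => ∫ ω, Z' t ω ∂P) I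

namespace IsPathwiseDeriv

variable {Ω E : Type*} [MeasurableSpace Ω] [NormedAddCommGroup E] [NormedSpace ℝ E]
  {I : Set ℝ} {Z Z' : ℝ → Ω → E} {P : Measure Ω} {a b : ℝ}

theorem integrable_uncurry [SFinite P] (H : IsPathwiseDeriv I Z Z' P) (hI : I.OrdConnected)
    (ha : a ∈ I) (hb : b ∈ I) :
    Integrable (Function.uncurry Z') ((volume.restrict (uIoc a b)).prod P) := by
  have hsub : uIcc a b ⊆ I := hI.uIcc_subset ha hb
  have hsub' : uIoc a b ⊆ I := uIoc_subset_uIcc.trans hsub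
  have hmeas : AEStronglyMeasurable (Function.uncurry Z')
      ((volume.restrict (uIoc a b)).prod P) :=
    aestronglyMeasurable_uncurry_of_ae_continuousOn measurableSet_uIoc
      (fun t ht => (H.integrable_deriv t (hsub' ht)).aestronglyMeasurable)
      (H.ae_continuousOn.mono fun _ h => h.mono hsub')
  refine (integrable_prod_iff hmeas).2 ⟨?_, ?_⟩
  · exact ae_restrict_of_forall_mem measurableSet_uIoc fun t ht => H.integrable_deriv t (hsub' ht)
  · exact ((H.continuousOn_integral_norm.mono hsub).integrableOn_compact isCompact_uIcc).mono_set
      uIoc_subset_uIcc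

theorem ae_intervalIntegral_eq_sub [CompleteSpace E] (H : IsPathwiseDeriv I Z Z' P)
    (hI : I.OrdConnected) (ha : a ∈ I) (hb : b ∈ I) :
    ∀ᵐ ω ∂P, ∫ t in a..b, Z' t ω = Z b ω - Z a ω := by
  filter_upwards [H.hasDerivWithinAt, H.ae_continuousOn] with ω hderiv hcont
  exact intervalIntegral_eq_sub_of_hasDerivWithinAt hI hderiv hcont ha hb

variable [CompleteSpace E] [SFinite P]

theorem integrable_sub (H : IsPathwiseDeriv I Z Z' P) (hI : I.OrdConnected)
    (ha : a ∈ I) (hb : b ∈ I) : Integrable (fun ω => Z b ω - Z a ω) P := by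
  refine Integrable.congr ?_ (H.ae_intervalIntegral_eq_sub hI ha hb)
  simp only [intervalIntegral.intervalIntegral_eq_integral_uIoc]
  exact (H.integrable_uncurry hI ha hb).integral_prod_right.smul _

theorem integrable (H : IsPathwiseDeriv I Z Z' P) (hI : I.OrdConnected)
    (ha : a ∈ I) (hb : b ∈ I) (hZ : Integrable (Z a) P) : Integrable (Z b) P :=
  ((H.integrable_sub hI ha hb).add hZ).congr (ae_of_all _ fun _ => sub_add_cancel _ _)

theorem integral_sub_eq_intervalIntegral (H : IsPathwiseDeriv I Z Z' P) (hI : I.OrdConnected)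
    (ha : a ∈ I) (hb : b ∈ I) (hZ : Integrable (Z a) P) :
    ∫ ω, Z b ω ∂P - ∫ ω, Z a ω ∂P = ∫ t in a..b, ∫ ω, Z' t ω ∂P := by
  rw [intervalIntegral_integral_swap (H.integrable_uncurry hI ha hb),
    integral_congr_ae (H.ae_intervalIntegral_eq_sub hI ha hb),
    integral_sub (H.integrable hI ha hb hZ) hZ]

theorem hasDerivWithinAt_integral (H : IsPathwiseDeriv I Z Z' P) (hI : I.OrdConnected)
    (ha : a ∈ I) (hZ : Integrable (Z a) P) :
    HasDerivWithinAt (fun t => ∫ ω, Z t ω ∂P) (∫ ω, Z' a ω ∂P) I a :=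
  hasDerivWithinAt_of_sub_eq_intervalIntegral hI H.continuousOn_integral ha fun _ hb =>
    H.integral_sub_eq_intervalIntegral hI ha hb hZ

end IsPathwiseDeriv

/-- The functions `Z t`, `t ∈ I`, have integrable majorants that are locally uniform in `t`. -/
def LocallyDominated {T α E : Type*} [TopologicalSpace T] [MeasurableSpace α]
    [NormedAddCommGroup E] (I : Set T) (Z : T → α → E) (μ : Measure α) : Prop :=
  ∀ t₀ ∈ I, ∃ g : α → ℝ, Integrable g μ ∧ ∀ᶠ t in 𝓝[I] t₀, ∀ᵐ x ∂μ, ‖Z t x‖ ≤ g x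

namespace LocallyDominated

variable {T α E : Type*} [TopologicalSpace T] [MeasurableSpace α] [NormedAddCommGroup E]
  {I : Set T} {Z W : T → α → E} {μ : Measure α}

theorem add (hZ : LocallyDominated I Z μ) (hW : LocallyDominated I W μ) :
    LocallyDominated I (fun t x => Z t x + W t x) μ := by
  intro t₀ ht₀
  obtain ⟨g, hg, hZg⟩ := hZ t₀ ht₀
  obtain ⟨h, hh, hWh⟩ := hW t₀ ht₀
  refine ⟨g + h, hg.add hh, ?_⟩
  filter_upwards [hZg, hWh] with t hZt hWt
  filter_upwards [hZt, hWt] with x hZx hWx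
  exact norm_add_le_of_le hZx hWx

theorem mono_norm {F : Type*} [NormedAddCommGroup F] {W : T → α → F}
    (hZ : LocallyDominated I Z μ) (h : ∀ t ∈ I, ∀ x, ‖W t x‖ ≤ ‖Z t x‖) :
    LocallyDominated I W μ := by
  intro t₀ ht₀
  obtain ⟨g, hg, hZg⟩ := hZ t₀ ht₀
  refine ⟨g, hg, ?_⟩
  filter_upwards [hZg, self_mem_nhdsWithin] with t hZt ht
  filter_upwards [hZt] with x hZx
  exact (h t ht x).trans hZx

theorem integrable (hZ : LocallyDominated I Z μ) {t : T} (ht : t ∈ I)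
    (hmeas : AEStronglyMeasurable (Z t) μ) : Integrable (Z t) μ := by
  obtain ⟨g, hg, hZg⟩ := hZ t ht
  exact hg.mono' hmeas (hZg.self_of_nhdsWithin ht)

theorem continuousOn_integral [NormedSpace ℝ E] [FirstCountableTopology T]
    (hZ : LocallyDominated I Z μ) (hmeas : ∀ t ∈ I, AEStronglyMeasurable (Z t) μ)
    (hcont : ∀ x, ContinuousOn (fun t => Z t x) I) :
    ContinuousOn (fun t => ∫ x, Z t x ∂μ) I := by
  intro t₀ ht₀
  obtain ⟨g, hg, hZg⟩ := hZ t₀ ht₀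
  exact continuousWithinAt_of_dominated (eventually_mem_nhdsWithin.mono hmeas) hZg hg
    (ae_of_all _ fun x => hcont x t₀ ht₀)

end LocallyDominated

section TimeDependentFunction

theorem continuous_of_continuousOn_uncurry {T α β : Type*} [TopologicalSpace T]
    [TopologicalSpace α] [TopologicalSpace β] {S : Set T} {φ : T → α → β} {t : T}
    (hφ : ContinuousOn (Function.uncurry φ) (S ×ˢ univ)) (ht : t ∈ S) : Continuous (φ t) :=
  continuousOn_univ.1 (hφ.uncurry_left t ht)

variable {E : Type*} [NormedAddCommGroup E] {I : Set ℝ} {u : ℝ → E → ℝ} {t : ℝ}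

section NormedSpace

variable [NormedSpace ℝ E]

theorem contDiff_of_contDiffOn_uncurry {n : WithTop ℕ∞}
    (hu : ContDiffOn ℝ n (Function.uncurry u) (I ×ˢ univ)) (ht : t ∈ I) : ContDiff ℝ n (u t) := by
  rw [← contDiffOn_univ]
  exact hu.comp (f := fun y => (t, y)) (contDiff_prodMk_right t).contDiffOn
    fun y _ => ⟨ht, mem_univ y⟩

theorem hasFDerivWithinAt_uncurry (hu : ContDiffOn ℝ 1 (Function.uncurry u) (I ×ˢ univ))
    (ht : t ∈ I) (x : E) : HasFDerivWithinAt (Function.uncurry u)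
      (fderivWithin ℝ (Function.uncurry u) (I ×ˢ univ) (t, x)) (I ×ˢ univ) (t, x) :=
  (hu.differentiableOn one_ne_zero (t, x) ⟨ht, mem_univ x⟩).hasFDerivWithinAt

theorem hasDerivWithinAt_time (hu : ContDiffOn ℝ 1 (Function.uncurry u) (I ×ˢ univ))
    (ht : t ∈ I) (x : E) : HasDerivWithinAt (fun τ => u τ x)
      (fderivWithin ℝ (Function.uncurry u) (I ×ˢ univ) (t, x) (1, 0)) I t :=
  (hasFDerivWithinAt_uncurry hu ht x).comp_hasDerivWithinAt (f := fun τ => (τ, x)) t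
    ((hasDerivWithinAt_id t I).prodMk (hasDerivWithinAt_const t I x))
    fun _ hτ => ⟨hτ, mem_univ x⟩

theorem hasFDerivAt_space (hu : ContDiffOn ℝ 1 (Function.uncurry u) (I ×ˢ univ))
    (ht : t ∈ I) (x : E) : HasFDerivAt (u t)
      ((fderivWithin ℝ (Function.uncurry u) (I ×ˢ univ) (t, x)).comp
        (ContinuousLinearMap.inr ℝ ℝ E)) x := by
  rw [← hasFDerivWithinAt_univ]
  exact (hasFDerivWithinAt_uncurry hu ht x).comp (f := fun y => (t, y)) x
    (hasFDerivAt_prodMk_right t x).hasFDerivWithinAt fun y _ => ⟨ht, mem_univ y⟩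

theorem continuousOn_derivWithin_time (hI : UniqueDiffOn ℝ I)
    (hu : ContDiffOn ℝ 1 (Function.uncurry u) (I ×ˢ univ)) :
    ContinuousOn (Function.uncurry fun t x => derivWithin (fun τ => u τ x) I t)
      (I ×ˢ univ) := by
  have h := hu.continuousOn_fderivWithin (hI.prod uniqueDiffOn_univ) le_rfl
  refine (h.clm_apply (continuousOn_const (c := ((1 : ℝ), (0 : E))))).congr ?_
  rintro ⟨t, x⟩ ⟨ht, -⟩
  exact (hasDerivWithinAt_time hu ht x).derivWithin (hI t ht)

end NormedSpace

variable [InnerProductSpace ℝ E] [CompleteSpace E]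

theorem continuousOn_gradient_space (hI : UniqueDiffOn ℝ I)
    (hu : ContDiffOn ℝ 1 (Function.uncurry u) (I ×ˢ univ)) :
    ContinuousOn (Function.uncurry fun t x => gradient (u t) x) (I ×ˢ univ) := by
  have h := hu.continuousOn_fderivWithin (hI.prod uniqueDiffOn_univ) le_rfl
  refine ((InnerProductSpace.toDual ℝ E).symm.continuous.comp_continuousOn
    (h.clm_comp (continuousOn_const (c := ContinuousLinearMap.inr ℝ ℝ E)))).congr ?_
  rintro ⟨t, x⟩ ⟨ht, -⟩
  exact congrArg _ (hasFDerivAt_space hu ht x).fderiv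

theorem hasDerivWithinAt_comp_path (hI : UniqueDiffOn ℝ I)
    (hu : ContDiffOn ℝ 1 (Function.uncurry u) (I ×ˢ univ)) {γ : ℝ → E} {v : E} (ht : t ∈ I)
    (hγ : HasDerivWithinAt γ v I t) :
    HasDerivWithinAt (fun τ => u τ (γ τ))
      (derivWithin (fun τ => u τ (γ t)) I t + inner ℝ v (gradient (u t) (γ t))) I t := by
  have hchain := (hasFDerivWithinAt_uncurry hu ht (γ t)).comp_hasDerivWithinAt
    (f := fun τ => (τ, γ τ)) t ((hasDerivWithinAt_id t I).prodMk hγ) fun _ hτ => ⟨hτ, mem_univ _⟩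
  refine hchain.congr_deriv ?_
  rw [real_inner_comm, inner_gradient_left, (hasFDerivAt_space hu ht (γ t)).fderiv,
    (hasDerivWithinAt_time hu ht (γ t)).derivWithin (hI t ht), ContinuousLinearMap.comp_apply,
    ← map_add]
  simp

end TimeDependentFunction

section Densities

variable {d : ℕ} {p q : Space d → ℝ}

theorem integrable_densityMeasure_iff (hp : Measurable p) (hp₀ : ∀ x, 0 ≤ p x)
    {g : Space d → ℝ} : Integrable g (densityMeasure p) ↔ Integrable fun x => p x * g x := by
  rw [densityMeasure, integrable_withDensity_iff_integrable_smul' hp.ennreal_ofReal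
    (ae_of_all _ fun _ => ENNReal.ofReal_lt_top)]
  simp only [ENNReal.toReal_ofReal (hp₀ _), smul_eq_mul]

theorem integral_densityMeasure (hp : Measurable p) (hp₀ : ∀ x, 0 ≤ p x) (g : Space d → ℝ) :
    ∫ x, g x ∂(densityMeasure p) = ∫ x, p x * g x := by
  rw [densityMeasure, integral_withDensity_eq_integral_toReal_smul hp.ennreal_ofReal
    (ae_of_all _ fun _ => ENNReal.ofReal_lt_top)]
  simp only [ENNReal.toReal_ofReal (hp₀ _), smul_eq_mul]

theorem measureReal_univ_densityMeasure (hp : Measurable p) (hp₀ : ∀ x, 0 ≤ p x) :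
    (densityMeasure p).real univ = ∫ x, p x := by
  simpa using integral_densityMeasure hp hp₀ 1

theorem integrable_of_isFiniteMeasure_densityMeasure (hp : Measurable p) (hp₀ : ∀ x, 0 ≤ p x)
    [IsFiniteMeasure (densityMeasure p)] : Integrable p := by
  simpa using (integrable_densityMeasure_iff hp hp₀).1 (integrable_const 1)

theorem densityMeasure_absolutelyContinuous (hq : Measurable q) (hq₀ : ∀ x, 0 < q x) :
    densityMeasure p ≪ densityMeasure q :=
  (withDensity_absolutelyContinuous _ _).trans
    (withDensity_absolutelyContinuous' hq.ennreal_ofReal.aemeasurable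
      (ae_of_all _ fun x => (ENNReal.ofReal_pos.2 (hq₀ x)).ne'))

theorem llr_densityMeasure (hp : Measurable p) (hp₀ : ∀ x, 0 ≤ p x) (hq : Measurable q)
    (hq₀ : ∀ x, 0 < q x) :
    llr (densityMeasure p) (densityMeasure q) =ᵐ[densityMeasure p]
      fun x => Real.log (p x / q x) := by
  have : SigmaFinite (densityMeasure p) := SigmaFinite.withDensity_ofReal p
  have hrnDeriv_q : (densityMeasure p).rnDeriv (densityMeasure q) =ᵐ[volume]
      fun x => (ENNReal.ofReal (q x))⁻¹ * (densityMeasure p).rnDeriv volume x :=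
    Measure.rnDeriv_withDensity_right (densityMeasure p) volume hq.ennreal_ofReal.aemeasurable
      (ae_of_all _ fun x => (ENNReal.ofReal_pos.2 (hq₀ x)).ne')
      (ae_of_all _ fun x => ENNReal.ofReal_ne_top)
  have hrnDeriv_volume : (densityMeasure p).rnDeriv volume =ᵐ[volume]
      fun x => ENNReal.ofReal (p x) :=
    Measure.rnDeriv_withDensity volume hp.ennreal_ofReal
  refine (withDensity_absolutelyContinuous volume _).ae_le ?_
  filter_upwards [hrnDeriv_q, hrnDeriv_volume] with x hxq hxp
  rw [llr, hxq, hxp, ENNReal.toReal_mul, ENNReal.toReal_inv, ENNReal.toReal_ofReal (hp₀ x),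
    ENNReal.toReal_ofReal (hq₀ x).le, div_eq_inv_mul]

theorem klDiv_densityMeasure_ne_top_iff (hp : Measurable p) (hp₀ : ∀ x, 0 ≤ p x)
    (hq : Measurable q) (hq₀ : ∀ x, 0 < q x) :
    klDiv (densityMeasure p) (densityMeasure q) ≠ ∞ ↔
      Integrable (fun x => Real.log (p x / q x)) (densityMeasure p) := by
  rw [klDiv_ne_top_iff, integrable_congr (llr_densityMeasure hp hp₀ hq hq₀)]
  exact and_iff_right (densityMeasure_absolutelyContinuous hq hq₀)

theorem relEntropy_eq_integral_log (hp : Measurable p) (hp₀ : ∀ x, 0 ≤ p x)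
    (hq : Measurable q) (hq₀ : ∀ x, 0 < q x) [IsFiniteMeasure (densityMeasure p)]
    [IsFiniteMeasure (densityMeasure q)]
    (h : klDiv (densityMeasure p) (densityMeasure q) ≠ ∞) :
    relEntropy p q = ∫ x, Real.log (p x / q x) ∂(densityMeasure p) +
      (densityMeasure q).real univ - (densityMeasure p).real univ := by
  obtain ⟨hac, hint⟩ := klDiv_ne_top_iff.1 h
  rw [relEntropy, toReal_klDiv hac hint, integral_congr_ae (llr_densityMeasure hp hp₀ hq hq₀)]

theorem relScore_eq_sub {x : Space d} (hp : DifferentiableAt ℝ p x)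
    (hq : DifferentiableAt ℝ q x) (hp₀ : ∀ y, p y ≠ 0) (hq₀ : ∀ y, q y ≠ 0) :
    relScore p q x = score p x - score q x := by
  have hlog : (fun y => Real.log (p y / q y)) =
      (fun y => Real.log (p y)) - fun y => Real.log (q y) :=
    funext fun y => Real.log_div (hp₀ y) (hq₀ y)
  simp only [relScore, score, gradient, hlog]
  rw [fderiv_sub (hp.log (hp₀ x)) (hq.log (hq₀ x)), map_sub]

end Densities

section CauchySchwarz

theorem measurable_gradient {E : Type*} [NormedAddCommGroup E] [InnerProductSpace ℝ E]
    [CompleteSpace E] [MeasurableSpace E] [BorelSpace E] (u : E → ℝ) :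
    Measurable (gradient u) :=
  (InnerProductSpace.toDual ℝ E).symm.continuous.measurable.comp (measurable_fderiv ℝ u)

variable {𝕜 α E : Type*} [RCLike 𝕜] [MeasurableSpace α] {μ : Measure α} [NormedAddCommGroup E]
  [InnerProductSpace 𝕜 E] {u v : α → E}

theorem lintegral_enorm_inner_le (hu : AEStronglyMeasurable u μ) (hv : AEStronglyMeasurable v μ) :
    ∫⁻ x, ‖inner 𝕜 (u x) (v x)‖ₑ ∂μ ≤
      ((∫⁻ x, ‖u x‖ₑ ^ 2 ∂μ) * ∫⁻ x, ‖v x‖ₑ ^ 2 ∂μ) ^ (1 / 2 : ℝ) := by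
  have hHolder := ENNReal.lintegral_mul_le_Lp_mul_Lq μ Real.HolderConjugate.two_two
    hu.enorm hv.enorm
  simp only [ENNReal.rpow_two] at hHolder
  rw [ENNReal.mul_rpow_of_nonneg _ _ (by norm_num)]
  refine le_trans (lintegral_mono fun x => ?_) hHolder
  rw [Pi.mul_apply, ← ofReal_norm, ← ofReal_norm, ← ofReal_norm,
    ← ENNReal.ofReal_mul (norm_nonneg _)]
  exact ENNReal.ofReal_le_ofReal (norm_inner_le_norm _ _)

theorem integrable_inner_of_lintegral_mul_ne_top (hu : AEStronglyMeasurable u μ)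
    (hv : AEStronglyMeasurable v μ)
    (h : (∫⁻ x, ‖u x‖ₑ ^ 2 ∂μ) * ∫⁻ x, ‖v x‖ₑ ^ 2 ∂μ ≠ ∞) :
    Integrable (fun x => inner 𝕜 (u x) (v x)) μ :=
  ⟨hu.inner hv, (lintegral_enorm_inner_le hu hv).trans_lt
    (ENNReal.rpow_lt_top_of_nonneg (by norm_num) h)⟩

theorem norm_integral_inner_le_sqrt (hu : AEStronglyMeasurable u μ)
    (hv : AEStronglyMeasurable v μ)
    (h : (∫⁻ x, ‖u x‖ₑ ^ 2 ∂μ) * ∫⁻ x, ‖v x‖ₑ ^ 2 ∂μ ≠ ∞) :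
    ‖∫ x, inner 𝕜 (u x) (v x) ∂μ‖ ≤
      √((∫⁻ x, ‖u x‖ₑ ^ 2 ∂μ) * ∫⁻ x, ‖v x‖ₑ ^ 2 ∂μ).toReal := by
  rw [Real.sqrt_eq_rpow, ENNReal.toReal_rpow, ← toReal_enorm]
  exact ENNReal.toReal_mono (ENNReal.rpow_ne_top_of_nonneg (by norm_num) h)
    ((enorm_integral_le_lintegral_enorm _).trans (lintegral_enorm_inner_le hu hv))

end CauchySchwarz

section ScoreError

variable {d : ℕ} {s : Space d → Space d} {p q r : Space d → ℝ}

theorem inner_relScore_eq_sub (hp : Differentiable ℝ p) (hr : Differentiable ℝ r)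
    (hp₀ : ∀ x, p x ≠ 0) (hr₀ : ∀ x, r x ≠ 0) (x v : Space d) :
    inner ℝ (relScore p r x) v =
      inner ℝ (s x - score r x) v - inner ℝ (s x - score p x) v := by
  rw [relScore_eq_sub (hp x) (hr x) hp₀ hr₀, ← inner_sub_left, sub_sub_sub_cancel_left]

theorem integrable_inner_sub_score_relScore (hs : Measurable s)
    (h : scoreLoss s p * relFisher p q ≠ ∞) :
    Integrable (fun x => inner ℝ (s x - score p x) (relScore p q x)) (densityMeasure p) :=
  integrable_inner_of_lintegral_mul_ne_top
    (hs.sub (measurable_gradient _)).aestronglyMeasurable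
    (measurable_gradient _).aestronglyMeasurable h

theorem integrable_inner_relScore_relScore (hs : Measurable s) (hp : Differentiable ℝ p)
    (hr : Differentiable ℝ r) (hp₀ : ∀ x, p x ≠ 0) (hr₀ : ∀ x, r x ≠ 0)
    (hint : Integrable (fun x => inner ℝ (s x - score r x) (relScore p q x)) (densityMeasure p))
    (h : scoreLoss s p * relFisher p q ≠ ∞) :
    Integrable (fun x => inner ℝ (relScore p r x) (relScore p q x)) (densityMeasure p) := by
  simp only [inner_relScore_eq_sub (s := s) hp hr hp₀ hr₀]
  exact hint.sub (integrable_inner_sub_score_relScore hs h)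

theorem abs_integral_inner_sub_le_sqrt (hs : Measurable s) (hp : Differentiable ℝ p)
    (hr : Differentiable ℝ r) (hp₀ : ∀ x, p x ≠ 0) (hr₀ : ∀ x, r x ≠ 0)
    (hint : Integrable (fun x => inner ℝ (s x - score r x) (relScore p q x)) (densityMeasure p))
    (h : scoreLoss s p * relFisher p q ≠ ∞) :
    |∫ x, inner ℝ (s x - score r x) (relScore p q x) ∂(densityMeasure p) -
        ∫ x, inner ℝ (relScore p r x) (relScore p q x) ∂(densityMeasure p)| ≤
      √(scoreLoss s p * relFisher p q).toReal := by
  simp only [inner_relScore_eq_sub (s := s) hp hr hp₀ hr₀]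
  rw [integral_sub hint (integrable_inner_sub_score_relScore hs h), sub_sub_cancel]
  exact norm_integral_inner_le_sqrt (𝕜 := ℝ) (hs.sub (measurable_gradient _)).aestronglyMeasurable
    (measurable_gradient _).aestronglyMeasurable h

end ScoreError

theorem LocallyDominated.isPathwiseDeriv {Ω E : Type*} [MeasurableSpace Ω]
    [NormedAddCommGroup E] [NormedSpace ℝ E] {I : Set ℝ} {Z Z' : ℝ → Ω → E} {μ : Measure Ω}
    (hZ' : LocallyDominated I Z' μ) (hmeas : ∀ t ∈ I, AEStronglyMeasurable (Z' t) μ)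
    (hcont : ∀ ω, ContinuousOn (fun t => Z' t ω) I)
    (hderiv : ∀ ω, ∀ t ∈ I, HasDerivWithinAt (fun τ => Z τ ω) (Z' t ω) I t) :
    IsPathwiseDeriv I Z Z' μ where
  hasDerivWithinAt := ae_of_all _ hderiv
  ae_continuousOn := ae_of_all _ hcont
  integrable_deriv t ht := hZ'.integrable ht (hmeas t ht)
  continuousOn_integral_norm := (hZ'.mono_norm fun _ _ _ => (norm_norm _).le).continuousOn_integral
    (fun t ht => (hmeas t ht).norm) fun ω => (hcont ω).norm
  continuousOn_integral := hZ'.continuousOn_integral hmeas hcont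

section LogRatio

theorem contDiffOn_log_div {E : Type*} [NormedAddCommGroup E] [NormedSpace ℝ E] {I : Set ℝ}
    {f : ℝ → E → ℝ} {q : E → ℝ} {n : WithTop ℕ∞}
    (hf : ContDiffOn ℝ n (Function.uncurry f) (I ×ˢ univ)) (hf₀ : ∀ t ∈ I, ∀ x, f t x ≠ 0)
    (hq : ContDiff ℝ n q) (hq₀ : ∀ x, q x ≠ 0) :
    ContDiffOn ℝ n (Function.uncurry fun t x => Real.log (f t x / q x)) (I ×ˢ univ) :=
  (hf.div (hq.comp contDiff_snd).contDiffOn fun z _ => hq₀ z.2).log fun z hz =>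
    div_ne_zero (hf₀ z.1 hz.1 z.2) (hq₀ z.2)

theorem derivWithin_log_div_const {g : ℝ → ℝ} {I : Set ℝ} {t c : ℝ}
    (hI : UniqueDiffWithinAt ℝ I t) (hg : DifferentiableWithinAt ℝ g I t) (hg₀ : g t ≠ 0)
    (hc : c ≠ 0) :
    derivWithin (fun τ => Real.log (g τ / c)) I t = derivWithin g I t / g t := by
  rw [derivWithin.log (hg.div_const c) (div_ne_zero hg₀ hc) hI, derivWithin_div_const,
    div_div_div_cancel_right₀ hc]

end LogRatio

/-- `X` is a random solution over the time interval `I` of `dX_t/dt = v_t (X_t)`, with densities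
`f_t` regular enough for the total mass `∫ f_t` to be differentiated under the integral. -/
structure IsDensityFlow {d : ℕ} (I : Set ℝ) (v : ℝ → Space d → Space d) (f : ℝ → Space d → ℝ)
    {Ω : Type*} [MeasurableSpace Ω] (P : Measure Ω) (X : ℝ → Ω → Space d) : Prop where
  ode : ∀ᵐ ω ∂P, ∀ t ∈ I, HasDerivWithinAt (fun τ => X τ ω) (v t (X t ω)) I t
  law : ∀ t ∈ I, HasLaw (X t) (densityMeasure (f t)) P
  continuousOn_velocity : ContinuousOn (Function.uncurry v) (I ×ˢ univ)
  pos : ∀ t ∈ I, ∀ x, 0 < f t x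
  contDiffOn : ContDiffOn ℝ 1 (Function.uncurry f) (I ×ˢ univ)
  locallyDominated_deriv : LocallyDominated I (fun t x => derivWithin (fun τ => f τ x) I t) volume

/-- The rate of change of `log (f_t / q)` along the trajectories of `dx/dt = v_t (x)`. -/
noncomputable def logRatioMaterialDeriv {d : ℕ} (I : Set ℝ) (v : ℝ → Space d → Space d)
    (f : ℝ → Space d → ℝ) (q : Space d → ℝ) (t : ℝ) (x : Space d) : ℝ :=
  derivWithin (fun τ => f τ x) I t / f t x + inner ℝ (v t x) (relScore (f t) q x)

namespace IsDensityFlow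

variable {d : ℕ} {I : Set ℝ} {v : ℝ → Space d → Space d} {f : ℝ → Space d → ℝ}
  {q : Space d → ℝ} {Ω : Type*} [MeasurableSpace Ω] {P : Measure Ω} {X : ℝ → Ω → Space d}
  {t : ℝ}

section Law

theorem measurable_density (H : IsDensityFlow I v f P X) (ht : t ∈ I) : Measurable (f t) :=
  (contDiff_of_contDiffOn_uncurry H.contDiffOn ht).continuous.measurable

theorem integrable_comp_iff (H : IsDensityFlow I v f P X) (ht : t ∈ I) {g : Space d → ℝ}
    (hg : Measurable g) :
    Integrable (fun ω => g (X t ω)) P ↔ Integrable g (densityMeasure (f t)) := by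
  rw [← (H.law t ht).map_eq]
  exact (integrable_map_measure hg.aestronglyMeasurable (H.law t ht).aemeasurable).symm

theorem integral_comp (H : IsDensityFlow I v f P X) (ht : t ∈ I) {g : Space d → ℝ}
    (hg : Measurable g) : ∫ ω, g (X t ω) ∂P = ∫ x, g x ∂(densityMeasure (f t)) :=
  (H.law t ht).integral_comp hg.aestronglyMeasurable

theorem isFiniteMeasure_densityMeasure [IsFiniteMeasure P] (H : IsDensityFlow I v f P X)
    (ht : t ∈ I) : IsFiniteMeasure (densityMeasure (f t)) :=
  (H.law t ht).isFiniteMeasure_iff.1 inferInstance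

theorem measureReal_univ (H : IsDensityFlow I v f P X) (ht : t ∈ I) :
    (densityMeasure (f t)).real univ = P.real univ := by
  rw [← (H.law t ht).map_eq, map_measureReal_apply_of_aemeasurable (H.law t ht).aemeasurable .univ,
    preimage_univ]

theorem continuousOn_integral_comp (H : IsDensityFlow I v f P X) {φ : ℝ → Space d → ℝ}
    (hφ : ContinuousOn (Function.uncurry φ) (I ×ˢ univ))
    (hdom : LocallyDominated I (fun t x => f t x * φ t x) volume) :
    ContinuousOn (fun t => ∫ ω, φ t (X t ω) ∂P) I := by
  have hfφ : ContinuousOn (Function.uncurry fun t x => f t x * φ t x) (I ×ˢ univ) :=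
    H.contDiffOn.continuousOn.mul hφ
  refine (hdom.continuousOn_integral
    (fun _ ht => (continuous_of_continuousOn_uncurry hfφ ht).aestronglyMeasurable)
    fun x => hfφ.uncurry_right x (mem_univ x)).congr fun t ht => ?_
  rw [H.integral_comp ht (continuous_of_continuousOn_uncurry hφ ht).measurable,
    integral_densityMeasure (H.measurable_density ht) fun x => (H.pos t ht x).le]

end Law

section Mass

theorem continuousOn_derivWithin (H : IsDensityFlow I v f P X) (hI : UniqueDiffOn ℝ I) :
    ContinuousOn (Function.uncurry fun t x => derivWithin (fun τ => f τ x) I t) (I ×ˢ univ) :=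
  continuousOn_derivWithin_time hI H.contDiffOn

theorem integrable_derivWithin (H : IsDensityFlow I v f P X) (hI : UniqueDiffOn ℝ I) (ht : t ∈ I) :
    Integrable fun x => derivWithin (fun τ => f τ x) I t :=
  H.locallyDominated_deriv.integrable ht
    (continuous_of_continuousOn_uncurry (H.continuousOn_derivWithin hI) ht).aestronglyMeasurable

theorem isPathwiseDeriv_density (H : IsDensityFlow I v f P X) (hI : UniqueDiffOn ℝ I) :
    IsPathwiseDeriv I f (fun t x => derivWithin (fun τ => f τ x) I t) volume :=
  have hcont := H.continuousOn_derivWithin hI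
  H.locallyDominated_deriv.isPathwiseDeriv
    (fun _ ht => (continuous_of_continuousOn_uncurry hcont ht).aestronglyMeasurable)
    (fun x => hcont.uncurry_right x (mem_univ x)) fun x _ ht =>
      (hasDerivWithinAt_time H.contDiffOn ht x).differentiableWithinAt.hasDerivWithinAt

theorem integral_density_eq (H : IsDensityFlow I v f P X) (ht : t ∈ I) :
    ∫ x, f t x = P.real univ := by
  rw [← H.measureReal_univ ht,
    measureReal_univ_densityMeasure (H.measurable_density ht) fun x => (H.pos t ht x).le]

theorem integral_derivWithin_eq_zero [IsFiniteMeasure P] (H : IsDensityFlow I v f P X)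
    (hI : I.OrdConnected) (hI' : I.Nontrivial) (ht : t ∈ I) :
    ∫ x, derivWithin (fun τ => f τ x) I t = 0 := by
  have hU := uniqueDiffOn_of_ordConnected hI hI'
  have := H.isFiniteMeasure_densityMeasure ht
  have hf : Integrable (f t) :=
    integrable_of_isFiniteMeasure_densityMeasure (H.measurable_density ht)
      fun x => (H.pos t ht x).le
  have hderiv := (H.isPathwiseDeriv_density hU).hasDerivWithinAt_integral hI ht hf
  have hconst : HasDerivWithinAt (fun τ => ∫ x, f τ x) 0 I t :=
    (hasDerivWithinAt_const t I (P.real univ)).congr (fun _ hτ => H.integral_density_eq hτ)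
      (H.integral_density_eq ht)
  exact (hU t ht).eq_deriv _ hderiv hconst

end Mass

section RelativeEntropy

theorem contDiffOn_logRatio (H : IsDensityFlow I v f P X) (hq : ContDiff ℝ 1 q)
    (hq₀ : ∀ x, 0 < q x) :
    ContDiffOn ℝ 1 (Function.uncurry fun t x => Real.log (f t x / q x)) (I ×ˢ univ) :=
  contDiffOn_log_div H.contDiffOn (fun t ht x => (H.pos t ht x).ne') hq fun x => (hq₀ x).ne'

theorem continuousOn_inner_relScore (H : IsDensityFlow I v f P X) (hI : UniqueDiffOn ℝ I)
    (hq : ContDiff ℝ 1 q) (hq₀ : ∀ x, 0 < q x) :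
    ContinuousOn (Function.uncurry fun t x => inner ℝ (v t x) (relScore (f t) q x))
      (I ×ˢ univ) :=
  H.continuousOn_velocity.inner (continuousOn_gradient_space hI (H.contDiffOn_logRatio hq hq₀))

theorem integrable_inner_relScore (H : IsDensityFlow I v f P X) (hI : UniqueDiffOn ℝ I)
    (hq : ContDiff ℝ 1 q) (hq₀ : ∀ x, 0 < q x)
    (hD : LocallyDominated I (fun t x => f t x * inner ℝ (v t x) (relScore (f t) q x)) volume)
    (ht : t ∈ I) :
    Integrable (fun x => inner ℝ (v t x) (relScore (f t) q x)) (densityMeasure (f t)) := by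
  have hcont := continuous_of_continuousOn_uncurry (H.continuousOn_inner_relScore hI hq hq₀) ht
  rw [integrable_densityMeasure_iff (H.measurable_density ht) fun x => (H.pos t ht x).le]
  exact hD.integrable ht ((H.measurable_density ht).mul hcont.measurable).aestronglyMeasurable

theorem continuousOn_logRatioMaterialDeriv (H : IsDensityFlow I v f P X) (hI : UniqueDiffOn ℝ I)
    (hq : ContDiff ℝ 1 q) (hq₀ : ∀ x, 0 < q x) :
    ContinuousOn (Function.uncurry (logRatioMaterialDeriv I v f q)) (I ×ˢ univ) :=
  ((H.continuousOn_derivWithin hI).div H.contDiffOn.continuousOn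
    fun z hz => (H.pos z.1 hz.1 z.2).ne').add (H.continuousOn_inner_relScore hI hq hq₀)

theorem measurable_logRatioMaterialDeriv (H : IsDensityFlow I v f P X) (hI : UniqueDiffOn ℝ I)
    (hq : ContDiff ℝ 1 q) (hq₀ : ∀ x, 0 < q x) (ht : t ∈ I) :
    Measurable (logRatioMaterialDeriv I v f q t) :=
  (continuous_of_continuousOn_uncurry (H.continuousOn_logRatioMaterialDeriv hI hq hq₀)
    ht).measurable

theorem mul_logRatioMaterialDeriv (H : IsDensityFlow I v f P X) (ht : t ∈ I) (x : Space d) :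
    f t x * logRatioMaterialDeriv I v f q t x =
      derivWithin (fun τ => f τ x) I t + f t x * inner ℝ (v t x) (relScore (f t) q x) := by
  rw [logRatioMaterialDeriv, mul_add, mul_div_cancel₀ _ (H.pos t ht x).ne']

theorem locallyDominated_mul_logRatioMaterialDeriv (H : IsDensityFlow I v f P X)
    (hD : LocallyDominated I (fun t x => f t x * inner ℝ (v t x) (relScore (f t) q x)) volume) :
    LocallyDominated I (fun t x => f t x * logRatioMaterialDeriv I v f q t x) volume :=
  (H.locallyDominated_deriv.add hD).mono_norm fun t ht x => by
    rw [H.mul_logRatioMaterialDeriv ht]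

theorem hasDerivWithinAt_log_div_comp (H : IsDensityFlow I v f P X) (hI : UniqueDiffOn ℝ I)
    (hq : ContDiff ℝ 1 q) (hq₀ : ∀ x, 0 < q x) {γ : ℝ → Space d} (ht : t ∈ I)
    (hγ : HasDerivWithinAt γ (v t (γ t)) I t) :
    HasDerivWithinAt (fun τ => Real.log (f τ (γ τ) / q (γ τ)))
      (logRatioMaterialDeriv I v f q t (γ t)) I t := by
  refine (hasDerivWithinAt_comp_path hI (H.contDiffOn_logRatio hq hq₀) ht hγ).congr_deriv ?_
  rw [derivWithin_log_div_const (hI t ht)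
    (hasDerivWithinAt_time H.contDiffOn ht (γ t)).differentiableWithinAt
    (H.pos t ht (γ t)).ne' (hq₀ (γ t)).ne']
  rfl

theorem isPathwiseDeriv_log_div (H : IsDensityFlow I v f P X) (hI : UniqueDiffOn ℝ I)
    (hq : ContDiff ℝ 1 q) (hq₀ : ∀ x, 0 < q x)
    (hD : LocallyDominated I (fun t x => f t x * inner ℝ (v t x) (relScore (f t) q x)) volume) :
    IsPathwiseDeriv I (fun t ω => Real.log (f t (X t ω) / q (X t ω)))
      (fun t ω => logRatioMaterialDeriv I v f q t (X t ω)) P where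
  hasDerivWithinAt := H.ode.mono fun _ hω t ht =>
    H.hasDerivWithinAt_log_div_comp hI hq hq₀ ht (hω t ht)
  ae_continuousOn := H.ode.mono fun _ hω =>
    (H.continuousOn_logRatioMaterialDeriv hI hq hq₀).comp
      (continuousOn_id.prodMk fun t ht => (hω t ht).continuousWithinAt)
      fun _ ht => ⟨ht, mem_univ _⟩
  integrable_deriv t ht := by
    have hmeas := H.measurable_logRatioMaterialDeriv hI hq hq₀ ht
    rw [H.integrable_comp_iff ht hmeas,
      integrable_densityMeasure_iff (H.measurable_density ht) fun x => (H.pos t ht x).le]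
    exact (H.locallyDominated_mul_logRatioMaterialDeriv hD).integrable ht
      ((H.measurable_density ht).mul hmeas).aestronglyMeasurable
  continuousOn_integral_norm := by
    refine H.continuousOn_integral_comp (φ := fun t x => ‖logRatioMaterialDeriv I v f q t x‖)
      (H.continuousOn_logRatioMaterialDeriv hI hq hq₀).norm
      ((H.locallyDominated_mul_logRatioMaterialDeriv hD).mono_norm fun t _ x => ?_)
    rw [norm_mul, norm_norm, norm_mul]
  continuousOn_integral := H.continuousOn_integral_comp
    (H.continuousOn_logRatioMaterialDeriv hI hq hq₀)
    (H.locallyDominated_mul_logRatioMaterialDeriv hD)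

theorem integral_logRatioMaterialDeriv_comp [IsFiniteMeasure P] (H : IsDensityFlow I v f P X)
    (hI : I.OrdConnected) (hI' : I.Nontrivial) (hq : ContDiff ℝ 1 q) (hq₀ : ∀ x, 0 < q x)
    (hD : LocallyDominated I (fun t x => f t x * inner ℝ (v t x) (relScore (f t) q x)) volume)
    (ht : t ∈ I) :
    ∫ ω, logRatioMaterialDeriv I v f q t (X t ω) ∂P =
      ∫ x, inner ℝ (v t x) (relScore (f t) q x) ∂(densityMeasure (f t)) := by
  have hU := uniqueDiffOn_of_ordConnected hI hI'
  have hf := H.measurable_density ht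
  have hf₀ : ∀ x, 0 ≤ f t x := fun x => (H.pos t ht x).le
  have hint := H.integrable_inner_relScore hU hq hq₀ hD ht
  rw [H.integral_comp ht (H.measurable_logRatioMaterialDeriv hU hq hq₀ ht),
    integral_densityMeasure hf hf₀, integral_densityMeasure hf hf₀]
  simp only [H.mul_logRatioMaterialDeriv ht]
  rw [integral_add (H.integrable_derivWithin hU ht) ((integrable_densityMeasure_iff hf hf₀).1 hint),
    H.integral_derivWithin_eq_zero hI hI' ht, zero_add]

theorem measurable_log_div (H : IsDensityFlow I v f P X) (hq : Measurable q) (ht : t ∈ I) :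
    Measurable fun x => Real.log (f t x / q x) :=
  ((H.measurable_density ht).div hq).log

theorem integrable_log_div_comp_iff (H : IsDensityFlow I v f P X) (hq : Measurable q)
    (hq₀ : ∀ x, 0 < q x) (ht : t ∈ I) :
    Integrable (fun ω => Real.log (f t (X t ω) / q (X t ω))) P ↔
      klDiv (densityMeasure (f t)) (densityMeasure q) ≠ ∞ := by
  rw [H.integrable_comp_iff ht (H.measurable_log_div hq ht),
    klDiv_densityMeasure_ne_top_iff (H.measurable_density ht) (fun x => (H.pos t ht x).le) hq hq₀]

theorem klDiv_ne_top [SFinite P] (H : IsDensityFlow I v f P X)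
    (hI : I.OrdConnected) (hI' : I.Nontrivial) (hq : ContDiff ℝ 1 q) (hq₀ : ∀ x, 0 < q x)
    (hD : LocallyDominated I (fun t x => f t x * inner ℝ (v t x) (relScore (f t) q x)) volume)
    {t₀ : ℝ} (ht₀ : t₀ ∈ I) (hfin : klDiv (densityMeasure (f t₀)) (densityMeasure q) ≠ ∞)
    (ht : t ∈ I) : klDiv (densityMeasure (f t)) (densityMeasure q) ≠ ∞ := by
  have hlog := H.isPathwiseDeriv_log_div (uniqueDiffOn_of_ordConnected hI hI') hq hq₀ hD
  rw [← H.integrable_log_div_comp_iff hq.continuous.measurable hq₀ ht]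
  exact hlog.integrable hI ht₀ ht
    ((H.integrable_log_div_comp_iff hq.continuous.measurable hq₀ ht₀).2 hfin)

theorem relEntropy_eq [IsFiniteMeasure P] [IsFiniteMeasure (densityMeasure q)]
    (H : IsDensityFlow I v f P X) (hq : Measurable q) (hq₀ : ∀ x, 0 < q x) (ht : t ∈ I)
    (hfin : klDiv (densityMeasure (f t)) (densityMeasure q) ≠ ∞) :
    relEntropy (f t) q = ∫ ω, Real.log (f t (X t ω) / q (X t ω)) ∂P +
      (densityMeasure q).real univ - P.real univ := by
  have := H.isFiniteMeasure_densityMeasure ht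
  rw [relEntropy_eq_integral_log (H.measurable_density ht) (fun x => (H.pos t ht x).le) hq hq₀ hfin,
    H.measureReal_univ ht, H.integral_comp ht (H.measurable_log_div hq ht)]

theorem hasDerivWithinAt_relEntropy [IsFiniteMeasure P] [IsFiniteMeasure (densityMeasure q)]
    (H : IsDensityFlow I v f P X)
    (hI : I.OrdConnected) (hI' : I.Nontrivial) (hq : ContDiff ℝ 1 q) (hq₀ : ∀ x, 0 < q x)
    (hD : LocallyDominated I (fun t x => f t x * inner ℝ (v t x) (relScore (f t) q x)) volume)
    (hfin : ∀ τ ∈ I, klDiv (densityMeasure (f τ)) (densityMeasure q) ≠ ∞) (ht : t ∈ I) :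
    HasDerivWithinAt (fun τ => relEntropy (f τ) q)
      (∫ x, inner ℝ (v t x) (relScore (f t) q x) ∂(densityMeasure (f t))) I t := by
  have hqm : Measurable q := hq.continuous.measurable
  have hlog := H.isPathwiseDeriv_log_div (uniqueDiffOn_of_ordConnected hI hI') hq hq₀ hD
  have hderiv := hlog.hasDerivWithinAt_integral hI ht
    ((H.integrable_log_div_comp_iff hqm hq₀ ht).2 (hfin t ht))
  rw [H.integral_logRatioMaterialDeriv_comp hI hI' hq hq₀ hD ht] at hderiv
  exact ((hderiv.add_const _).sub_const _).congr
    (fun τ hτ => H.relEntropy_eq hqm hq₀ hτ (hfin τ hτ)) (H.relEntropy_eq hqm hq₀ ht (hfin t ht))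

end RelativeEntropy

end IsDensityFlow

section Asymptotics

theorem isBigO_sqrt_toReal_of_norm_le_sqrt_mul {ι E : Type*} [Norm E] {l : Filter ι}
    {u : ι → E} {L F : ι → ℝ≥0∞} {C : ℝ≥0} (hL : ∀ᶠ i in l, L i ≠ ∞) (hF : ∀ᶠ i in l, F i ≤ C)
    (hu : ∀ᶠ i in l, L i * F i ≠ ∞ → ‖u i‖ ≤ √(L i * F i).toReal) :
    u =O[l] fun i => √(L i).toReal := by
  refine IsBigO.of_bound √C ?_
  filter_upwards [hL, hF, hu] with i hLi hFi hui
  calc ‖u i‖ ≤ √(L i * F i).toReal :=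
        hui (ENNReal.mul_ne_top hLi (ne_top_of_le_ne_top ENNReal.coe_ne_top hFi))
    _ = √(F i).toReal * √(L i).toReal := by
        rw [ENNReal.toReal_mul, mul_comm, Real.sqrt_mul ENNReal.toReal_nonneg]
    _ ≤ √C * ‖√(L i).toReal‖ := by
        rw [Real.norm_of_nonneg (Real.sqrt_nonneg _)]
        gcongr
        exact ENNReal.toReal_le_coe_of_le_coe hFi

theorem tendsto_sqrt_toReal_zero {ι : Type*} {l : Filter ι} {L : ι → ℝ≥0∞}
    (hL : Tendsto L l (𝓝 0)) : Tendsto (fun i => √(L i).toReal) l (𝓝 0) := by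
  simpa using ((ENNReal.tendsto_toReal ENNReal.zero_ne_top).comp hL).sqrt

end Asymptotics

namespace IsAnnealedDynamics

variable {d : ℕ} {I : Set ℝ} {π : Space d → ℝ} {πt : ℝ → Space d → ℝ}
  {s : ℝ → Space d → Space d} {f : ℝ → Space d → ℝ} {Ω : Type*} [MeasurableSpace Ω]
  {P : Measure Ω} {X : ℝ → Ω → Space d} {t : ℝ}

theorem isDensityFlow (H : IsAnnealedDynamics I π πt s f P X)
    (hπt : ContinuousOn (fun z : ℝ × Space d => score (πt z.1) z.2) (I ×ˢ univ)) :
    IsDensityFlow I (fun t x => score (πt t) x - s t x) f P X where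
  ode := H.ode
  law := H.law
  continuousOn_velocity := hπt.sub H.continuousOn_field
  pos := H.pos
  contDiffOn := H.contDiffOn
  locallyDominated_deriv t ht := (H.dominated_deriv t ht).imp fun _ hg =>
    ⟨hg.1, hg.2.mono fun _ h => ae_of_all _ h⟩

theorem locallyDominated_mul_inner (H : IsAnnealedDynamics I π πt s f P X) :
    LocallyDominated I
      (fun t x => f t x * inner ℝ (score (πt t) x - s t x) (relScore (f t) π x)) volume := by
  intro t₀ ht₀
  obtain ⟨g, hg, hfg⟩ := H.dominated_dissipation t₀ ht₀
  refine ⟨g, hg, ?_⟩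
  filter_upwards [hfg, self_mem_nhdsWithin] with t hfgt ht
  refine ae_of_all _ fun x => ?_
  rw [norm_mul, Real.norm_of_nonneg (H.pos t ht x).le, ← neg_sub, inner_neg_left, norm_neg]
  exact hfgt x

theorem klDiv_ne_top [SFinite P] (H : IsAnnealedDynamics I π πt s f P X)
    (hI : I.OrdConnected) (hI' : I.Nontrivial) (hπ : ContDiff ℝ 1 π) (hπ₀ : ∀ x, 0 < π x)
    (hπt : ContinuousOn (fun z : ℝ × Space d => score (πt z.1) z.2) (I ×ˢ univ)) (ht : t ∈ I) :
    klDiv (densityMeasure (f t)) (densityMeasure π) ≠ ∞ := by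
  obtain ⟨t₀, ht₀, hfin⟩ := H.finite_entropy
  exact (H.isDensityFlow hπt).klDiv_ne_top hI hI' hπ hπ₀ H.locallyDominated_mul_inner ht₀ hfin ht

theorem integrable_inner_relScore (H : IsAnnealedDynamics I π πt s f P X)
    (hI : UniqueDiffOn ℝ I) (hπ : ContDiff ℝ 1 π) (hπ₀ : ∀ x, 0 < π x)
    (hπt : ContinuousOn (fun z : ℝ × Space d => score (πt z.1) z.2) (I ×ˢ univ)) (ht : t ∈ I) :
    Integrable (fun x => inner ℝ (s t x - score (πt t) x) (relScore (f t) π x))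
      (densityMeasure (f t)) := by
  have h := (H.isDensityFlow hπt).integrable_inner_relScore hI hπ hπ₀
    H.locallyDominated_mul_inner ht
  simpa only [← inner_neg_left, neg_sub] using h.fun_neg

theorem hasDerivWithinAt_relEntropy [IsFiniteMeasure P] [IsFiniteMeasure (densityMeasure π)]
    (H : IsAnnealedDynamics I π πt s f P X)
    (hI : I.OrdConnected) (hI' : I.Nontrivial) (hπ : ContDiff ℝ 1 π) (hπ₀ : ∀ x, 0 < π x)
    (hπt : ContinuousOn (fun z : ℝ × Space d => score (πt z.1) z.2) (I ×ˢ univ)) (ht : t ∈ I) :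
    HasDerivWithinAt (fun τ => relEntropy (f τ) π)
      (-∫ x, inner ℝ (s t x - score (πt t) x) (relScore (f t) π x) ∂(densityMeasure (f t)))
      I t := by
  have h := (H.isDensityFlow hπt).hasDerivWithinAt_relEntropy hI hI' hπ hπ₀
    H.locallyDominated_mul_inner (fun _ hτ => H.klDiv_ne_top hI hI' hπ hπ₀ hπt hτ) ht
  simpa only [← integral_neg, ← inner_neg_left, neg_sub] using h

theorem measurable_field (H : IsAnnealedDynamics I π πt s f P X) (ht : t ∈ I) :
    Measurable (s t) :=
  (continuous_of_continuousOn_uncurry H.continuousOn_field ht).measurable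

theorem differentiable_density (H : IsAnnealedDynamics I π πt s f P X) (ht : t ∈ I) :
    Differentiable ℝ (f t) :=
  (contDiff_of_contDiffOn_uncurry H.contDiffOn ht).differentiable one_ne_zero

theorem integrable_inner_relScore_relScore (H : IsAnnealedDynamics I π πt s f P X)
    (hI : UniqueDiffOn ℝ I) (hπ : ContDiff ℝ 1 π) (hπ₀ : ∀ x, 0 < π x)
    (hπt₀ : ∀ t ∈ I, ∀ x, 0 < πt t x) (hπt₁ : ∀ t ∈ I, Differentiable ℝ (πt t))
    (hπt : ContinuousOn (fun z : ℝ × Space d => score (πt z.1) z.2) (I ×ˢ univ)) (ht : t ∈ I)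
    (h : scoreLoss (s t) (f t) * relFisher (f t) π ≠ ∞) :
    Integrable (fun x => inner ℝ (relScore (f t) (πt t) x) (relScore (f t) π x))
      (densityMeasure (f t)) :=
  _root_.integrable_inner_relScore_relScore (H.measurable_field ht) (H.differentiable_density ht)
    (hπt₁ t ht) (fun x => (H.pos t ht x).ne') (fun x => (hπt₀ t ht x).ne')
    (H.integrable_inner_relScore hI hπ hπ₀ hπt ht) h

theorem abs_integral_inner_sub_le (H : IsAnnealedDynamics I π πt s f P X)
    (hI : UniqueDiffOn ℝ I) (hπ : ContDiff ℝ 1 π) (hπ₀ : ∀ x, 0 < π x)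
    (hπt₀ : ∀ t ∈ I, ∀ x, 0 < πt t x) (hπt₁ : ∀ t ∈ I, Differentiable ℝ (πt t))
    (hπt : ContinuousOn (fun z : ℝ × Space d => score (πt z.1) z.2) (I ×ˢ univ)) (ht : t ∈ I)
    (h : scoreLoss (s t) (f t) * relFisher (f t) π ≠ ∞) :
    |∫ x, inner ℝ (s t x - score (πt t) x) (relScore (f t) π x) ∂(densityMeasure (f t)) -
        ∫ x, inner ℝ (relScore (f t) (πt t) x) (relScore (f t) π x) ∂(densityMeasure (f t))| ≤
      √(scoreLoss (s t) (f t) * relFisher (f t) π).toReal :=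
  abs_integral_inner_sub_le_sqrt (H.measurable_field ht) (H.differentiable_density ht)
    (hπt₁ t ht) (fun x => (H.pos t ht x).ne') (fun x => (hπt₀ t ht x).ne')
    (H.integrable_inner_relScore hI hπ hπ₀ hπt ht) h

end IsAnnealedDynamics

theorem mainTheorem4_general {d : ℕ}
    (I : Set ℝ) (hI : I.OrdConnected) (hI' : I.Nontrivial)
    (π : Space d → ℝ) (hπ_pos : ∀ x, 0 < π x) (hπ_smooth : ContDiff ℝ 1 π)
    (hπ_int : Integrable π)
    (πt : ℝ → Space d → ℝ) (hπt_pos : ∀ t ∈ I, ∀ x, 0 < πt t x)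
    (hπt_diff : ∀ t ∈ I, Differentiable ℝ (πt t))
    (hπt_score : ContinuousOn (fun z : ℝ × Space d => score (πt z.1) z.2) (I ×ˢ univ))
    {ι : Type*} (s : ι → ℝ → Space d → Space d) (f : ι → ℝ → Space d → ℝ)
    {Ω : ι → Type*} [∀ i, MeasurableSpace (Ω i)] (P : ∀ i, Measure (Ω i))
    [∀ i, IsFiniteMeasure (P i)] (X : ∀ i, ℝ → Ω i → Space d)
    (hX : ∀ i, IsAnnealedDynamics I π πt (s i) (f i) (P i) (X i)) :
    (∀ i, ∀ t ∈ I,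
      klDiv (densityMeasure (f i t)) (densityMeasure π) ≠ ∞ ∧
      Integrable (fun x => inner ℝ (s i t x - score (πt t) x) (relScore (f i t) π x))
        (densityMeasure (f i t)) ∧
      HasDerivWithinAt (fun τ => relEntropy (f i τ) π)
        (-∫ x, inner ℝ (s i t x - score (πt t) x) (relScore (f i t) π x)
          ∂(densityMeasure (f i t))) I t ∧
      (scoreLoss (s i t) (f i t) * relFisher (f i t) π ≠ ∞ →
        Integrable (fun x => inner ℝ (relScore (f i t) (πt t) x) (relScore (f i t) π x))
          (densityMeasure (f i t)) ∧
        |(∫ x, inner ℝ (s i t x - score (πt t) x) (relScore (f i t) π x)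
              ∂(densityMeasure (f i t)))
            - ∫ x, inner ℝ (relScore (f i t) (πt t) x) (relScore (f i t) π x)
              ∂(densityMeasure (f i t))|
          ≤ √(scoreLoss (s i t) (f i t) * relFisher (f i t) π).toReal)) ∧
    (∀ (l : Filter ι) (t : ι → ℝ), (∀ i, t i ∈ I) →
      (∃ C : ℝ≥0, ∀ᶠ i in l, relFisher (f i (t i)) π ≤ C) →
      Tendsto (fun i => scoreLoss (s i (t i)) (f i (t i))) l (𝓝 0) →
      Tendsto (fun i => -derivWithin (fun τ => relEntropy (f i τ) π) I (t i)
          - ∫ x, inner ℝ (relScore (f i (t i)) (πt (t i)) x) (relScore (f i (t i)) π x)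
            ∂(densityMeasure (f i (t i)))) l (𝓝 0) ∧
      (fun i => -derivWithin (fun τ => relEntropy (f i τ) π) I (t i)
          - ∫ x, inner ℝ (relScore (f i (t i)) (πt (t i)) x) (relScore (f i (t i)) π x)
            ∂(densityMeasure (f i (t i))))
        =O[l] fun i => √(scoreLoss (s i (t i)) (f i (t i))).toReal) := by
  have hU := uniqueDiffOn_of_ordConnected hI hI'
  have : IsFiniteMeasure (densityMeasure π) := isFiniteMeasure_withDensity_ofReal hπ_int.2
  have hderiv i t ht := (hX i).hasDerivWithinAt_relEntropy (t := t) hI hI' hπ_smooth hπ_pos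
    hπt_score ht
  have hbound i t ht := (hX i).abs_integral_inner_sub_le (t := t) hU hπ_smooth hπ_pos hπt_pos
    hπt_diff hπt_score ht
  refine ⟨fun i t ht => ⟨(hX i).klDiv_ne_top hI hI' hπ_smooth hπ_pos hπt_score ht,
    (hX i).integrable_inner_relScore hU hπ_smooth hπ_pos hπt_score ht, hderiv i t ht,
    fun hLF => ⟨(hX i).integrable_inner_relScore_relScore hU hπ_smooth hπ_pos hπt_pos hπt_diff
      hπt_score ht hLF, hbound i t ht hLF⟩⟩, ?_⟩
  rintro l t ht ⟨C, hF⟩ hL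
  have hO := isBigO_sqrt_toReal_of_norm_le_sqrt_mul (hL.eventually_ne ENNReal.zero_ne_top) hF
    (.of_forall fun i h => (Real.norm_eq_abs _).trans_le (hbound i (t i) (ht i) h))
  simp only [fun i => (hderiv i (t i) (ht i)).derivWithin (hU _ (ht i)), neg_neg]
  exact ⟨hO.trans_tendsto (tendsto_sqrt_toReal_zero hL), hO⟩

theorem mainTheorem4 {d : ℕ}
    -- the time interval
    (I : Set ℝ) (hI : I.OrdConnected) (hI' : I.Nontrivial)
    -- the target probability density `π`
    (π : Space d → ℝ) (hπ_pos : ∀ x, 0 < π x) (hπ_smooth : ContDiff ℝ 1 π)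
    (hπ_mass : ∫ x, π x = 1)
    -- the annealing path `π_t`
    (πt : ℝ → Space d → ℝ) (hπt_pos : ∀ t ∈ I, ∀ x, 0 < πt t x)
    (hπt_diff : ∀ t ∈ I, Differentiable ℝ (πt t))
    (hπt_score : ContinuousOn (fun z : ℝ × Space d => score (πt z.1) z.2) (I ×ˢ univ))
    -- a family of vector fields `s`, densities `f` and processes `X`
    {ι : Type*} (s : ι → ℝ → Space d → Space d) (f : ι → ℝ → Space d → ℝ)
    {Ω : ι → Type*} [∀ i, MeasurableSpace (Ω i)] (P : ∀ i, Measure (Ω i))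
    [∀ i, IsProbabilityMeasure (P i)] (X : ∀ i, ℝ → Ω i → Space d)
    (hX : ∀ i, IsAnnealedDynamics I π πt (s i) (f i) (P i) (X i)) :
    -- the dissipation identity and the bound, for each member of the family and each time
    (∀ i, ∀ t ∈ I,
      klDiv (densityMeasure (f i t)) (densityMeasure π) ≠ ∞ ∧
      Integrable (fun x => inner ℝ (s i t x - score (πt t) x) (relScore (f i t) π x))
        (densityMeasure (f i t)) ∧
      HasDerivWithinAt (fun τ => relEntropy (f i τ) π)
        (-∫ x, inner ℝ (s i t x - score (πt t) x) (relScore (f i t) π x)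
          ∂(densityMeasure (f i t))) I t ∧
      (scoreLoss (s i t) (f i t) * relFisher (f i t) π ≠ ∞ →
        Integrable (fun x => inner ℝ (relScore (f i t) (πt t) x) (relScore (f i t) π x))
          (densityMeasure (f i t)) ∧
        |(∫ x, inner ℝ (s i t x - score (πt t) x) (relScore (f i t) π x)
              ∂(densityMeasure (f i t)))
            - ∫ x, inner ℝ (relScore (f i t) (πt t) x) (relScore (f i t) π x)
              ∂(densityMeasure (f i t))|
          ≤ √(scoreLoss (s i t) (f i t) * relFisher (f i t) π).toReal)) ∧
    -- convergence at the rate `O(√L)` as the loss tends to zero along the family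
    (∀ (l : Filter ι) (t : ι → ℝ), (∀ i, t i ∈ I) →
      (∃ C : ℝ≥0, ∀ᶠ i in l, relFisher (f i (t i)) π ≤ C) →
      Tendsto (fun i => scoreLoss (s i (t i)) (f i (t i))) l (𝓝 0) →
      Tendsto (fun i => -derivWithin (fun τ => relEntropy (f i τ) π) I (t i)
          - ∫ x, inner ℝ (relScore (f i (t i)) (πt (t i)) x) (relScore (f i (t i)) π x)
            ∂(densityMeasure (f i (t i)))) l (𝓝 0) ∧
      (fun i => -derivWithin (fun τ => relEntropy (f i τ) π) I (t i)
          - ∫ x, inner ℝ (relScore (f i (t i)) (πt (t i)) x) (relScore (f i (t i)) π x)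
            ∂(densityMeasure (f i (t i))))
        =O[l] fun i => √(scoreLoss (s i (t i)) (f i (t i))).toReal) :=
  mainTheorem4_general I hI hI' π hπ_pos hπ_smooth (integrable_of_integral_eq_one hπ_mass)
    πt hπt_pos hπt_diff hπt_score s f P X hX
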